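/- All normed spaces are real. For a normed space $X$, $S_X$ is its unit sphere, $X^*$ its topological dual with the dual norm, and $\operatorname{dens}(X)$ is the least cardinality of a dense subset of $X$. For $\lambda\in(0,1)$, a set $B\subset X$ is said to $\lambda$-norm a set $A\subset X^*$ if for every $x^*\in A$ there is $x\in B\setminus\{0\}$ with $x^*(x)\ge\lambda\|x^*\|\|x\|$, and $B$ norms $A$ if it $\lambda$-norms $A$ for every $\lambda\in(0,1)$. Let $\kappa$ be an infinite cardinal. * $X$ has the SD2P$_\kappa$ (strong diameter two property with respect to $\kappa$) if for every $A\subset S_{X^*}$ of cardinality at most $\kappa$ and every $\lambda\in(0,1)$ there are $B\subset S_X$ and $x^*\in S_{X^*}$ such that $B$ $\lambda$-norms $A$ and $x^*(x)\ge\lambda$ for every $x\in B$. * $X$ has the 1-ASD2P$_\kappa$ (1-norming attaining strong diameter two property with respect to $\kappa$) if for every $A\subset S_{X^*}$ of cardinality at most $\kappa$ there are $B\subset S_X$ and $x^*\in S_{X^*}$ such that $B$ norms $A$ and $x^*(x)=1$ for every $x\in B$. * $X$ is $\kappa$-octahedral if for every linear subspace $Y\subset X$ with $\operatorname{dens}(Y)\le\kappa$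 and every $\varepsilon>0$ there is $x\in S_X$ such that $\|y+\lambda x\|\ge(1-\varepsilon)(\|y\|+|\lambda|)$ for all $y\in Y$ and $\lambda\in\mathbb R$. * $X$ fails the $(-1)$-BCP$_\kappa$ (the $(-1)$-ball-covering property with respect to $\kappa$) if for every linear subspace $Y\subset X$ with $\operatorname{dens}(Y)\le\kappa$ there is $x\in S_X$ such that $\|y+\lambda x\|\ge\|y\|+|\lambda|$ for all $y\in Y$ and $\lambda\in\mathbb R$. Corollary 6.5. Let $K$ be a compact Hausdorff space, let $C(K)$ be the space of continuous real-valued functions on $K$ with the supremum norm, and let $\omega$ denote the first infinite cardinal. The following are equivalent: (i) $|K|\ge\omega_1$, that is, $K$ is uncountable; (ii) $C(K)$ has the SD2P$_\omega$; (iii) $C(K)$ has the 1-ASD2P$_\omega$; (iv) $C(K)^*$ is non-separable (in the norm topology); (v) $C(K)^*$ is $\omega$-octahedral; (vi) $C(K)^*$ fails the $(-1)$-BCP$_\omega$. -/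

import Mathlib

open scoped Cardinal

namespace CKDiameterTwo

universe u

/-- The density character: the least cardinality of a dense subset. -/
noncomputable def dens (X : Type u) [TopologicalSpace X] : Cardinal.{u} :=
  sInf {c : Cardinal.{u} | ∃ D : Set X, Dense D ∧ #D = c}

section

variable {X : Type u} [NormedAddCommGroup X] [NormedSpace ℝ X]

/-- `B ⊆ X` `lam`-norms `A ⊆ X*`. -/
def LamNorms (lam : ℝ) (B : Set X) (A : Set (StrongDual ℝ X)) : Prop :=
  ∀ f ∈ A, ∃ x ∈ B \ {0}, lam * (‖x‖ * ‖f‖) ≤ f x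

/-- `B ⊆ X` norms `A ⊆ X*`. -/
def Norms (B : Set X) (A : Set (StrongDual ℝ X)) : Prop :=
  ∀ lam ∈ Set.Ioo (0 : ℝ) 1, LamNorms lam B A

/-- The inequality `‖y + t x‖ ≥ (1 - ε) (‖y‖ + |t|)` for all `y ∈ Y` and all scalars `t`. -/
def OctIneq (Y : Submodule ℝ X) (ε : ℝ) (x : X) : Prop :=
  ∀ y ∈ Y, ∀ t : ℝ, (1 - ε) * (‖y‖ + |t|) ≤ ‖y + t • x‖

end

variable (X : Type u) [NormedAddCommGroup X] [NormedSpace ℝ X]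

/-- The couple `(X, Y)`, with `Y` a subspace of `X*`, has the strong diameter two property with
respect to `κ`. -/
def CoupleSD2P (Y : Submodule ℝ (StrongDual ℝ X)) (κ : Cardinal.{u}) : Prop :=
  ∀ A : Set (StrongDual ℝ X), (∀ f ∈ A, f ∈ Y ∧ ‖f‖ = 1) → #A ≤ κ →
    ∀ lam ∈ Set.Ioo (0 : ℝ) 1, ∃ B : Set X, B ⊆ Metric.sphere 0 1 ∧
      ∃ g : StrongDual ℝ X, ‖g‖ = 1 ∧ LamNorms lam B A ∧ ∀ x ∈ B, lam ≤ g x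

/-- The couple `(X, Y)`, with `Y` a subspace of `X*`, has the 1-norming attaining strong diameter
two property with respect to `κ`. -/
def CoupleOneASD2P (Y : Submodule ℝ (StrongDual ℝ X)) (κ : Cardinal.{u}) : Prop :=
  ∀ A : Set (StrongDual ℝ X), (∀ f ∈ A, f ∈ Y ∧ ‖f‖ = 1) → #A ≤ κ →
    ∃ B : Set X, B ⊆ Metric.sphere 0 1 ∧
      ∃ g : StrongDual ℝ X, ‖g‖ = 1 ∧ Norms B A ∧ ∀ x ∈ B, g x = 1

/-- `X` has the strong diameter two property with respect to `κ`: the couple `(X, X*)` has it. -/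
def SD2P (κ : Cardinal.{u}) : Prop := CoupleSD2P X ⊤ κ

/-- `X` has the 1-norming attaining strong diameter two property with respect to `κ`: the couple
`(X, X*)` has it. -/
def OneASD2P (κ : Cardinal.{u}) : Prop := CoupleOneASD2P X ⊤ κ

/-- `X` is `κ`-octahedral. -/
def IsOctahedral (κ : Cardinal.{u}) : Prop :=
  ∀ Y : Submodule ℝ X, dens Y ≤ κ → ∀ ε : ℝ, 0 < ε → ∃ x : X, ‖x‖ = 1 ∧ OctIneq Y ε x

/-- `X` fails the `(-1)`-ball-covering property with respect to `κ`: the condition defining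
`κ`-octahedral spaces holds with `ε = 0`. -/
def FailsNegOneBCP (κ : Cardinal.{u}) : Prop :=
  ∀ Y : Submodule ℝ X, dens Y ≤ κ → ∃ x : X, ‖x‖ = 1 ∧ OctIneq Y 0 x

end CKDiameterTwo

/-!
Everything is done with functionals on `C(K, ℝ)` directly, without representing them by measures.

Call `x` a *null point* of a functional `μ` if `μ` is arbitrarily small on the functions of norm at
most one that live in a small enough neighbourhood of `x`; in terms of the representing measure,
`|μ| {x} = 0`. Points that are not null carry a definite amount of the norm of `μ`, so there are
only countably many of them (`countable_setOf_not_isNullPoint`). At a null point `x`, a function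
that almost norms `μ` can be changed near `x` so as to take any prescribed value in `[-1, 1]` there,
at almost no cost (`IsNullPoint.exists_apply_eq`). If `K` is uncountable, every countable set of
functionals has a common null point `x`, and then the evaluation `δ_x` solves both problems at once:
it is a witness for the 1-ASD2P, together with the norm-one functions equal to `1` at `x`, and
`‖μ + t δ_x‖ = ‖μ‖ + |t|` for all `μ` in the closure of the given set.

Conversely, all these properties fail when the dual is separable: a dense sequence of functionals
comes close to `-g` for the functional `g` which the SD2P provides, and octahedrality applied to the
whole dual gives `x` with `‖x - x‖ > 0`. Finally, the dual is separable when `K` is countable,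
because the evaluations then span a dense subspace (`exists_mem_span_norm_sub_le`). Indeed, every
point has a neighbourhood in which `μ` is small on functions vanishing at that point
(`exists_isOpen_abs_le`). As `K` is countable, the error bounds can be taken summable over the
points, and a partition of unity subordinate to finitely many of these neighbourhoods approximates
`μ` by a finite combination of evaluations.
-/

namespace CKDiameterTwo

universe u

variable {K : Type u} [TopologicalSpace K] [CompactSpace K]

/-! ### Evaluation functionals and norming functions -/

/-- The evaluation functional `δ_x` on `C(K, ℝ)`. -/
noncomputable abbrev evalDual (x : K) : StrongDual ℝ C(K, ℝ) := ContinuousMap.evalCLM ℝ x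

theorem norm_evalDual (x : K) : ‖evalDual x‖ = 1 := by
  refine le_antisymm (ContinuousLinearMap.opNorm_le_bound _ zero_le_one fun f => ?_) ?_
  · simpa using f.norm_coe_le_norm x
  · have : Nonempty K := ⟨x⟩
    have h := (evalDual x).le_opNorm 1
    simpa using h

theorem exists_norm_le_one_lt_apply {X : Type*} [NormedAddCommGroup X] [NormedSpace ℝ X]
    (μ : StrongDual ℝ X) {r : ℝ} (hr : r < ‖μ‖) : ∃ f : X, ‖f‖ ≤ 1 ∧ r < μ f := by
  obtain ⟨f, hf, hrf⟩ := ContinuousLinearMap.exists_lt_apply_of_lt_opNorm μ hr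
  rcases le_total 0 (μ f) with h | h
  · exact ⟨f, hf.le, by rwa [Real.norm_of_nonneg h] at hrf⟩
  · exact ⟨-f, by rw [norm_neg]; exact hf.le, by rwa [Real.norm_of_nonpos h, ← map_neg] at hrf⟩

theorem norm_sum_le_one_of_pairwiseDisjoint {ι : Type*} {s : Finset ι} {U : ι → Set K}
    {f : ι → C(K, ℝ)} (hU : (s : Set ι).PairwiseDisjoint U) (hf : ∀ i ∈ s, ‖f i‖ ≤ 1)
    (hfU : ∀ i ∈ s, ∀ y ∉ U i, f i y = 0) : ‖∑ i ∈ s, f i‖ ≤ 1 := by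
  rw [ContinuousMap.norm_le _ zero_le_one]
  intro y
  rw [ContinuousMap.sum_apply]
  by_cases h : ∃ i ∈ s, y ∈ U i
  · obtain ⟨i, hi, hy⟩ := h
    rw [Finset.sum_eq_single i]
    · exact ((f i).norm_coe_le_norm y).trans (hf i hi)
    · intro j hj hji
      exact hfU j hj y fun hyj => (hU hj hi hji).le_bot ⟨hyj, hy⟩
    · exact fun h => absurd hi h
  · push Not at h
    rw [Finset.sum_eq_zero fun i hi => hfU i hi y (h i hi)]
    simp

/-! ### Null points -/

/-- `x` is a null point of `μ` if `μ` is arbitrarily small on the part of the unit ball consisting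
of the functions that vanish off a small neighbourhood of `x`. If `μ` is given by a signed measure,
this means that `{x}` has total variation zero. -/
def IsNullPoint (μ : StrongDual ℝ C(K, ℝ)) (x : K) : Prop :=
  ∀ ε > 0, ∃ U : Set K, IsOpen U ∧ x ∈ U ∧
    ∀ f : C(K, ℝ), ‖f‖ ≤ 1 → (∀ y ∉ U, f y = 0) → μ f ≤ ε

theorem countable_setOf_not_isNullPoint [T2Space K] (μ : StrongDual ℝ C(K, ℝ)) :
    {x | ¬ IsNullPoint μ x}.Countable := by
  let S : ℕ → Set K := fun n => {x | ∀ U : Set K, IsOpen U → x ∈ U →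
    ∃ f : C(K, ℝ), ‖f‖ ≤ 1 ∧ (∀ y ∉ U, f y = 0) ∧ 1 / ((n : ℝ) + 1) ≤ μ f}
  have hS : ∀ n, (S n).Finite := by
    intro n
    by_contra hinf
    -- With `m > ‖μ‖ (n + 1)` points, the sum of functions living near them separately has norm at
    -- most one, but `μ` exceeds `‖μ‖` on it.
    obtain ⟨m, hm⟩ := exists_nat_gt (‖μ‖ * ((n : ℝ) + 1))
    obtain ⟨s, hsS, hsm⟩ := Set.Infinite.exists_subset_card_eq hinf m
    obtain ⟨U, hU, hdisj⟩ := s.finite_toSet.t2_separation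
    have hex : ∀ x : K, ∃ f : C(K, ℝ), x ∈ s →
        ‖f‖ ≤ 1 ∧ (∀ y ∉ U x, f y = 0) ∧ 1 / ((n : ℝ) + 1) ≤ μ f := by
      intro x
      by_cases hx : x ∈ s
      · obtain ⟨f, hf⟩ := hsS hx (U x) (hU x).2 (hU x).1
        exact ⟨f, fun _ => hf⟩
      · exact ⟨0, fun h => absurd h hx⟩
    choose f hf using hex
    have hsum : ‖∑ x ∈ s, f x‖ ≤ 1 := norm_sum_le_one_of_pairwiseDisjoint hdisj
      (fun x hx => (hf x hx).1) (fun x hx => (hf x hx).2.1)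
    have h1 : μ (∑ x ∈ s, f x) ≤ ‖μ‖ :=
      (le_abs_self _).trans (μ.unit_le_opNorm _ hsum)
    have h2 : (m : ℝ) * (1 / ((n : ℝ) + 1)) ≤ μ (∑ x ∈ s, f x) := by
      rw [map_sum, ← hsm, ← nsmul_eq_mul]
      exact Finset.card_nsmul_le_sum _ _ _ fun x hx => (hf x hx).2.2
    have hn : (0 : ℝ) < (n : ℝ) + 1 := by positivity
    rw [mul_one_div] at h2
    have := (div_le_iff₀ hn).1 (h2.trans h1)
    linarith
  refine (Set.countable_iUnion fun n => (hS n).countable).mono ?_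
  intro x hx
  simp only [IsNullPoint, Set.mem_ofPred_eq] at hx
  push Not at hx
  obtain ⟨ε, hε, h⟩ := hx
  obtain ⟨n, hn⟩ := exists_nat_one_div_lt hε
  refine Set.mem_iUnion.2 ⟨n, fun U hU hxU => ?_⟩
  obtain ⟨f, hf, hfU, hμ⟩ := h U hU hxU
  exact ⟨f, hf, hfU, hn.le.trans hμ.le⟩

/-- Almost norming functions of `μ` can take any admissible value at a null point of `μ`. -/
theorem IsNullPoint.exists_apply_eq [T2Space K] {μ : StrongDual ℝ C(K, ℝ)} {x : K}
    (h : IsNullPoint μ x) {r s : ℝ} (hr : r < ‖μ‖) (hs : |s| ≤ 1) :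
    ∃ f : C(K, ℝ), ‖f‖ ≤ 1 ∧ f x = s ∧ r < μ f := by
  set ε : ℝ := (‖μ‖ - r) / 4 with hε
  have hε0 : 0 < ε := by linarith
  obtain ⟨f, hf, hμf⟩ := exists_norm_le_one_lt_apply μ (r := ‖μ‖ - ε) (by linarith)
  obtain ⟨U, hU, hxU, hUμ⟩ := h ε hε0
  obtain ⟨p, hpU, hpx, hp⟩ := exists_continuous_zero_one_of_isClosed hU.isClosed_compl
    (isClosed_singleton (x := x)) (by simpa using hxU)
  have hpx : p x = 1 := hpx rfl
  have hf' : ∀ y, |f y| ≤ 1 := fun y => (f.norm_coe_le_norm y).trans hf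
  -- Replace `f` by the convex combination `(1 - p) f + p s`.
  set g : C(K, ℝ) := p * (ContinuousMap.const K s - f) with hg
  have hgU : ∀ y ∉ U, g y = 0 := fun y hy => by simp [hg, show p y = 0 from hpU hy]
  have hg1 : ‖(-(1 / 2 : ℝ)) • g‖ ≤ 1 := by
    rw [ContinuousMap.norm_le _ zero_le_one]
    intro y
    have h1 := abs_le.1 (hf' y)
    have h2 := abs_le.1 hs
    have h3 := hp y
    simp only [hg, ContinuousMap.smul_apply, ContinuousMap.mul_apply, ContinuousMap.sub_apply,
      ContinuousMap.const_apply, smul_eq_mul, Real.norm_eq_abs, abs_mul, abs_neg]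
    have h4 : |p y| ≤ 1 := abs_le.2 ⟨by linarith [h3.1], h3.2⟩
    have h5 : |s - f y| ≤ 2 := abs_le.2 ⟨by linarith, by linarith⟩
    have h6 : |p y| * |s - f y| ≤ 1 * 2 := mul_le_mul h4 h5 (abs_nonneg _) zero_le_one
    rw [abs_of_pos (by norm_num : (0 : ℝ) < 1 / 2)]
    linarith
  have hμg := hUμ _ hg1 fun y hy => by simp [hgU y hy]
  rw [map_smul, smul_eq_mul] at hμg
  refine ⟨f + g, ?_, by simp [hg, hpx], ?_⟩
  · rw [ContinuousMap.norm_le _ zero_le_one]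
    intro y
    have h1 := abs_le.1 (hf' y)
    have h2 := abs_le.1 hs
    have h3 := hp y
    simp only [hg, ContinuousMap.add_apply, ContinuousMap.mul_apply, ContinuousMap.sub_apply,
      ContinuousMap.const_apply, Real.norm_eq_abs]
    rw [abs_le]
    constructor <;>
      nlinarith [mul_nonneg h3.1 (by linarith : (0 : ℝ) ≤ 1 - s),
        mul_nonneg h3.1 (by linarith : (0 : ℝ) ≤ 1 + s),
        mul_nonneg (by linarith [h3.2] : (0 : ℝ) ≤ 1 - p y) (by linarith : (0 : ℝ) ≤ 1 - f y),
        mul_nonneg (by linarith [h3.2] : (0 : ℝ) ≤ 1 - p y) (by linarith : (0 : ℝ) ≤ 1 + f y)]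
  · rw [map_add]
    linarith

theorem IsNullPoint.norm_add_abs_le [T2Space K] {μ : StrongDual ℝ C(K, ℝ)} {x : K}
    (h : IsNullPoint μ x) (t : ℝ) : ‖μ‖ + |t| ≤ ‖μ + t • evalDual x‖ := by
  refine le_of_forall_pos_sub_le fun ε hε => ?_
  obtain ⟨s, hs, hst⟩ : ∃ s : ℝ, |s| ≤ 1 ∧ t * s = |t| := by
    rcases le_total 0 t with ht | ht
    · exact ⟨1, by simp, by simp [abs_of_nonneg ht]⟩
    · exact ⟨-1, by simp, by simp [abs_of_nonpos ht]⟩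
  obtain ⟨f, hf, hfx, hμf⟩ := h.exists_apply_eq (r := ‖μ‖ - ε) (by linarith) hs
  have h1 := (le_abs_self _).trans ((μ + t • evalDual x).unit_le_opNorm f hf)
  have h2 : (μ + t • evalDual x) f = μ f + |t| := by
    simp [hfx, hst]
  linarith

theorem exists_forall_isNullPoint [T2Space K] (hK : ℵ₁ ≤ #K) {A : Set (StrongDual ℝ C(K, ℝ))}
    (hA : A.Countable) : ∃ x : K, ∀ μ ∈ A, IsNullPoint μ x := by
  have hc : (⋃ μ ∈ A, {x | ¬ IsNullPoint μ x}).Countable :=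
    hA.biUnion fun μ _ => countable_setOf_not_isNullPoint μ
  have hunc : Uncountable K := by
    rw [← Cardinal.aleph0_lt_mk_iff]
    exact Cardinal.aleph_one_le_iff.1 hK
  by_contra hcon
  push Not at hcon
  refine Set.not_countable_univ (hc.mono fun x _ => ?_)
  obtain ⟨μ, hμ, hx⟩ := hcon x
  exact Set.mem_biUnion hμ hx

/-! ### Uncountable compact spaces -/

theorem oneASD2P_of_aleph_one_le [T2Space K] (hK : ℵ₁ ≤ #K) : OneASD2P C(K, ℝ) ℵ₀ := by
  intro A hA hAc
  obtain ⟨x, hx⟩ := exists_forall_isNullPoint hK (Cardinal.mk_le_aleph0_iff.1 hAc)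
  refine ⟨{f | ‖f‖ = 1 ∧ f x = 1}, fun f hf => by simpa using hf.1, evalDual x, norm_evalDual x,
    fun lam hlam μ hμ => ?_, fun f hf => hf.2⟩
  have hμ1 := (hA μ hμ).2
  obtain ⟨f, hf, hfx, hμf⟩ := (hx μ hμ).exists_apply_eq (r := lam) (s := 1)
    (by rw [hμ1]; exact hlam.2) (by simp)
  have hf1 : ‖f‖ = 1 := le_antisymm hf (by simpa [hfx] using f.norm_coe_le_norm x)
  refine ⟨f, ⟨⟨hf1, hfx⟩, fun h0 => ?_⟩, by rw [hf1, hμ1]; linarith⟩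
  rw [Set.mem_singleton_iff.1 h0, norm_zero] at hf1
  exact zero_ne_one hf1

/-- A space has density at most `ℵ₀` exactly when it is separable; here is the implication that
makes use of the infimum in the definition of `dens` being attained. -/
theorem exists_countable_dense_of_dens_le {X : Type u} [TopologicalSpace X] (h : dens X ≤ ℵ₀) :
    ∃ D : Set X, D.Countable ∧ Dense D := by
  obtain ⟨D, hD, hc⟩ := csInf_mem (s := {c : Cardinal.{u} | ∃ D : Set X, Dense D ∧ #D = c})
    ⟨_, Set.univ, dense_univ, rfl⟩
  exact ⟨D, Cardinal.mk_le_aleph0_iff.1 (hc.trans_le h), hD⟩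

theorem octIneq_zero_of_dense {X : Type*} [NormedAddCommGroup X] [NormedSpace ℝ X]
    {Y : Submodule ℝ X} {D : Set Y} (hD : Dense D) {x : X}
    (h : ∀ z ∈ D, ∀ t : ℝ, ‖(z : X)‖ + |t| ≤ ‖(z : X) + t • x‖) : OctIneq Y 0 x := by
  intro y hy t
  rw [sub_zero, one_mul]
  have hcl : IsClosed {z : Y | ‖(z : X)‖ + |t| ≤ ‖(z : X) + t • x‖} :=
    isClosed_le (by fun_prop) (by fun_prop)
  exact hcl.closure_subset_iff.2 (fun z hz => h z hz t) (hD ⟨y, hy⟩)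

theorem failsNegOneBCP_of_aleph_one_le [T2Space K] (hK : ℵ₁ ≤ #K) :
    FailsNegOneBCP (StrongDual ℝ C(K, ℝ)) ℵ₀ := by
  intro Y hY
  obtain ⟨D, hDc, hD⟩ := exists_countable_dense_of_dens_le hY
  obtain ⟨x, hx⟩ := exists_forall_isNullPoint hK (hDc.image ((↑) : Y → StrongDual ℝ C(K, ℝ)))
  exact ⟨evalDual x, norm_evalDual x, octIneq_zero_of_dense hD fun z hz t =>
    (hx _ (Set.mem_image_of_mem _ hz)).norm_add_abs_le t⟩

/-! ### Spaces with a separable dual -/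

theorem not_separableSpace_of_SD2P {X : Type u} [NormedAddCommGroup X] [NormedSpace ℝ X]
    (h : SD2P X ℵ₀) : ¬ TopologicalSpace.SeparableSpace (StrongDual ℝ X) := by
  intro hsep
  obtain ⟨A, hAS, hAc, hAd⟩ := (TopologicalSpace.IsSeparable.of_separableSpace
    (Metric.sphere (0 : StrongDual ℝ X) 1)).exists_countable_dense_subset
  obtain ⟨B, hB, g, hg, hBA, hgB⟩ := h A (fun f hf => ⟨trivial, by simpa using hAS hf⟩)
    (Cardinal.mk_le_aleph0_iff.2 hAc) (3 / 4) ⟨by norm_num, by norm_num⟩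
  obtain ⟨f, hf, hfg⟩ := Metric.mem_closure_iff.1 (hAd (show -g ∈ _ by simpa using hg)) (1 / 2)
    (by norm_num)
  obtain ⟨x, ⟨hxB, -⟩, hx⟩ := hBA f hf
  have hf1 : ‖f‖ = 1 := by simpa using hAS hf
  have hx1 : ‖x‖ = 1 := by simpa using hB hxB
  have h1 := hgB x hxB
  have h2 : (g + f) x ≤ ‖g + f‖ := (le_abs_self _).trans ((g + f).unit_le_opNorm x hx1.le)
  rw [dist_eq_norm, show -g - f = -(g + f) by abel, norm_neg] at hfg
  rw [hf1, hx1] at hx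
  rw [add_apply] at h2
  linarith

theorem IsOctahedral.not_separableSpace {X : Type u} [NormedAddCommGroup X] [NormedSpace ℝ X]
    (h : IsOctahedral X ℵ₀) : ¬ TopologicalSpace.SeparableSpace X := by
  intro hsep
  have hd : dens (⊤ : Submodule ℝ X) ≤ ℵ₀ := by
    have : TopologicalSpace.SeparableSpace (⊤ : Submodule ℝ X) :=
      (TopologicalSpace.IsSeparable.of_separableSpace
        ((⊤ : Submodule ℝ X) : Set X)).separableSpace
    obtain ⟨D, hDc, hD⟩ := TopologicalSpace.exists_countable_dense (⊤ : Submodule ℝ X)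
    have hle : dens (⊤ : Submodule ℝ X) ≤ #D := csInf_le' ⟨D, hD, rfl⟩
    exact hle.trans (Cardinal.mk_le_aleph0_iff.2 hDc)
  obtain ⟨x, hx, hoct⟩ := h ⊤ hd (1 / 2) (by norm_num)
  have := hoct x trivial (-1)
  norm_num [hx] at this

/-! ### Countable compact spaces -/

/-- Near each point, a functional is almost a multiple of the evaluation: it is at most `ε` on the
functions of norm at most one that live near `x` and vanish at `x`. -/
theorem exists_isOpen_apply_le (μ : StrongDual ℝ C(K, ℝ)) (x : K) {ε : ℝ} (hε : 0 < ε) :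
    ∃ U : Set K, IsOpen U ∧ x ∈ U ∧
      ∀ f : C(K, ℝ), ‖f‖ ≤ 1 → (∀ y ∉ U, f y = 0) → f x = 0 → μ f ≤ ε := by
  -- The supremum of `S` is the total variation of `{x}`.
  let S : Set ℝ := {r | ∀ U : Set K, IsOpen U → x ∈ U →
    ∃ f : C(K, ℝ), ‖f‖ ≤ 1 ∧ (∀ y ∉ U, f y = 0) ∧ r ≤ μ f}
  have hne : S.Nonempty := ⟨0, fun U _ _ => ⟨0, by simp, by simp, by simp⟩⟩
  have hbdd : BddAbove S := ⟨‖μ‖, fun r hr => by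
    obtain ⟨f, hf, -, hrf⟩ := hr Set.univ isOpen_univ trivial
    exact hrf.trans ((le_abs_self _).trans (μ.unit_le_opNorm f hf))⟩
  obtain ⟨r, hrS, hr⟩ := exists_lt_of_lt_csSup hne (show sSup S - ε / 4 < sSup S by linarith)
  have hnot : sSup S + ε / 4 ∉ S := fun h => by linarith [le_csSup hbdd h]
  simp only [S, Set.mem_ofPred_eq] at hnot
  push Not at hnot
  obtain ⟨U, hU, hxU, hUμ⟩ := hnot
  refine ⟨U, hU, hxU, fun f hf hfU hfx => ?_⟩
  set δ : ℝ := ε / (2 * (‖μ‖ + 1)) with hδ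
  have hμ0 := norm_nonneg μ
  have hδ0 : 0 < δ := by positivity
  have hδμ : ‖μ‖ * δ ≤ ε / 2 := by
    rw [hδ, ← mul_div_assoc, div_le_div_iff₀ (by positivity) (by norm_num)]
    nlinarith
  -- `c` is `f` truncated to `[-δ, δ]`, so that `f - c` vanishes on a neighbourhood `V` of `x`; this
  -- leaves room for a function living on `V` which carries the whole variation of `{x}`.
  let c : C(K, ℝ) := ⟨fun y => max (-δ) (min δ (f y)), by fun_prop⟩
  have hc : ∀ y, c y = max (-δ) (min δ (f y)) := fun y => rfl
  have hcn : ‖c‖ ≤ δ := by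
    rw [ContinuousMap.norm_le _ hδ0.le]
    intro y
    rw [hc, Real.norm_eq_abs, abs_le]
    exact ⟨le_max_left _ _, max_le (by linarith) (min_le_left _ _)⟩
  have hf' : ∀ y, |f y| ≤ 1 := fun y => (f.norm_coe_le_norm y).trans hf
  have hfc : ∀ y, |f y - c y| ≤ |f y| := by
    intro y
    rw [hc]
    rcases le_total 0 (f y) with h | h
    · rw [max_eq_right (le_min (by linarith) (by linarith)), abs_of_nonneg h, abs_of_nonneg]
      · linarith [le_min hδ0.le h]
      · linarith [min_le_right δ (f y)]
    · rw [min_eq_right (by linarith : f y ≤ δ), abs_of_nonpos h, abs_of_nonpos]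
      · linarith [max_le (neg_nonpos.2 hδ0.le) h]
      · linarith [le_max_right (-δ) (f y)]
  let V : Set K := U ∩ {y | |f y| < δ}
  have hV : IsOpen V := hU.inter (isOpen_lt (by fun_prop) continuous_const)
  have hfcV : ∀ y ∈ V, f y - c y = 0 := by
    intro y hy
    have hyδ : |f y| < δ := hy.2
    have := abs_lt.1 hyδ
    rw [hc, min_eq_right this.2.le, max_eq_right this.1.le, sub_self]
  obtain ⟨g, hg, hgV, hrg⟩ := hrS V hV ⟨hxU, by simpa [hfx] using hδ0⟩
  have hsum : ‖(f - c) + g‖ ≤ 1 := by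
    rw [ContinuousMap.norm_le _ zero_le_one]
    intro y
    rw [ContinuousMap.add_apply, ContinuousMap.sub_apply]
    by_cases hy : y ∈ V
    · rw [hfcV y hy, zero_add]
      exact (g.norm_coe_le_norm y).trans hg
    · rw [hgV y hy, add_zero]
      exact (hfc y).trans (hf' y)
  have hsumU : ∀ y ∉ U, ((f - c) + g) y = 0 := by
    intro y hy
    have h1 : f y - c y = 0 := by simpa [hfU y hy] using hfc y
    rw [ContinuousMap.add_apply, ContinuousMap.sub_apply, h1, hgV y fun h => hy h.1, add_zero]
  have h1 := hUμ _ hsum hsumU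
  have h2 : μ c ≤ ‖μ‖ * δ := (le_abs_self _).trans (μ.le_opNorm_of_le hcn)
  rw [map_add, map_sub] at h1
  linarith

theorem exists_isOpen_abs_le (μ : StrongDual ℝ C(K, ℝ)) (x : K) {ε : ℝ} (hε : 0 < ε) :
    ∃ U : Set K, IsOpen U ∧ x ∈ U ∧
      ∀ f : C(K, ℝ), (∀ y ∉ U, f y = 0) → f x = 0 → |μ f| ≤ ε * ‖f‖ := by
  obtain ⟨U, hU, hxU, h⟩ := exists_isOpen_apply_le μ x hε
  have key : ∀ f : C(K, ℝ), (∀ y ∉ U, f y = 0) → f x = 0 → μ f ≤ ε * ‖f‖ := by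
    intro f hfU hfx
    rcases eq_or_ne f 0 with rfl | hf
    · simp
    have hn : 0 < ‖f‖ := norm_pos_iff.2 hf
    have := h (‖f‖⁻¹ • f) (norm_smul_inv_norm (𝕜 := ℝ) hf).le
      (fun y hy => by simp [hfU y hy]) (by simp [hfx])
    rw [map_smul, smul_eq_mul, inv_mul_le_iff₀ hn] at this
    linarith
  refine ⟨U, hU, hxU, fun f hfU hfx => abs_le'.2 ⟨key f hfU hfx, ?_⟩⟩
  have := key (-f) (fun y hy => by simp [hfU y hy]) (by simp [hfx])
  rwa [map_neg, norm_neg] at this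

theorem exists_mem_span_norm_sub_le [T2Space K] [Countable K] (μ : StrongDual ℝ C(K, ℝ)) {ε : ℝ}
    (hε : 0 < ε) : ∃ ν ∈ Submodule.span ℝ (Set.range (evalDual (K := K))), ‖μ - ν‖ ≤ ε := by
  obtain ⟨e, he, a, hea, haε⟩ := NNReal.exists_pos_sum_of_countable
    (Real.toNNReal_pos.2 (half_pos hε)).ne' K
  choose U hU hxU hUμ using fun x => exists_isOpen_abs_le μ x (NNReal.coe_pos.2 (he x))
  obtain ⟨t, -, ht⟩ := isCompact_univ.elim_nhds_subcover U fun x _ => (hU x).mem_nhds (hxU x)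
  obtain ⟨p, hp⟩ := PartitionOfUnity.exists_isSubordinate_of_locallyFinite isClosed_univ
    (fun i : t => U i) (fun i => hU i) (locallyFinite_of_finite _) (by
      intro y hy
      obtain ⟨x, hx, hyx⟩ := Set.mem_iUnion₂.1 (ht hy)
      exact Set.mem_iUnion.2 ⟨⟨x, hx⟩, hyx⟩)
  have hsum : ∑ i, p i = 1 := by
    ext y
    have h := p.sum_eq_one (Set.mem_univ y)
    rw [finsum_eq_sum_of_fintype] at h
    rw [ContinuousMap.sum_apply, h, ContinuousMap.one_apply]
  refine ⟨∑ i, μ (p i) • evalDual (i : K), Submodule.sum_mem _ fun i _ =>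
    Submodule.smul_mem _ _ (Submodule.subset_span ⟨_, rfl⟩), ?_⟩
  refine ContinuousLinearMap.opNorm_le_bound _ hε.le fun f => ?_
  let q : t → C(K, ℝ) := fun i => (f - ContinuousMap.const K (f i)) * p i
  have hq : (μ - ∑ i, μ (p i) • evalDual (i : K)) f = ∑ i, μ (q i) := by
    have h1 : ∀ i, μ (q i) = μ (f * p i) - μ (p i) * f i := by
      intro i
      have : q i = f * p i - f i • p i := by
        ext y
        simp [q, sub_mul]
      rw [this, map_sub, map_smul, smul_eq_mul, mul_comm (f i)]
    rw [Finset.sum_congr rfl fun i _ => h1 i, Finset.sum_sub_distrib, ← map_sum, ← Finset.mul_sum,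
      hsum, mul_one]
    simp
  have hqn : ∀ i, ‖q i‖ ≤ 2 * ‖f‖ := by
    intro i
    rw [ContinuousMap.norm_le _ (by positivity)]
    intro y
    have h1 : |f y| ≤ ‖f‖ := f.norm_coe_le_norm y
    have h2 : |f i| ≤ ‖f‖ := f.norm_coe_le_norm i
    have h3 : |p i y| ≤ 1 := by
      rw [abs_of_nonneg (p.nonneg i y)]
      exact p.le_one i y
    have h4 : |f y - f i| ≤ 2 * ‖f‖ := (abs_sub _ _).trans (by linarith)
    calc ‖q i y‖ = |f y - f i| * |p i y| := by simp [q]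
      _ ≤ (2 * ‖f‖) * 1 := mul_le_mul h4 h3 (abs_nonneg _) (by positivity)
      _ = 2 * ‖f‖ := mul_one _
  have hqμ : ∀ i : t, |μ (q i)| ≤ e i * (2 * ‖f‖) := by
    intro i
    refine (hUμ i (q i) (fun y hy => ?_) (by simp [q])).trans
      (mul_le_mul_of_nonneg_left (hqn i) (e i).coe_nonneg)
    have : p i y = 0 := image_eq_zero_of_notMem_tsupport fun h => hy (hp i h)
    simp [q, this]
  have hes : ∑ i : t, (e i : ℝ) ≤ ε / 2 := by
    have h1 : ∑ i ∈ t, e i ≤ a := sum_le_hasSum t (fun _ _ => zero_le) hea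
    have h2 : ((∑ i ∈ t, e i : NNReal) : ℝ) ≤ ε / 2 := by
      rw [← Real.coe_toNNReal (ε / 2) (half_pos hε).le]
      exact NNReal.coe_le_coe.2 (h1.trans haε.le)
    rw [Finset.sum_coe_sort t fun i => (e i : ℝ)]
    simpa using h2
  rw [hq]
  calc ‖∑ i, μ (q i)‖ ≤ ∑ i, |μ (q i)| := norm_sum_le _ _
    _ ≤ ∑ i : t, (e i : ℝ) * (2 * ‖f‖) := Finset.sum_le_sum fun i _ => hqμ i
    _ = (∑ i : t, (e i : ℝ)) * (2 * ‖f‖) := by rw [Finset.sum_mul]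
    _ ≤ ε / 2 * (2 * ‖f‖) := mul_le_mul_of_nonneg_right hes (by positivity)
    _ = ε * ‖f‖ := by ring

theorem separableSpace_dual_of_countable [T2Space K] [Countable K] :
    TopologicalSpace.SeparableSpace (StrongDual ℝ C(K, ℝ)) := by
  rw [← TopologicalSpace.isSeparable_univ_iff]
  refine ((Set.countable_range (evalDual (K := K))).isSeparable.span (R := ℝ)).closure.mono
    fun μ _ => (Metric.mem_closure_iff (α := StrongDual ℝ C(K, ℝ))).2 fun ε hε => ?_
  obtain ⟨ν, hν, hμν⟩ := exists_mem_span_norm_sub_le μ (half_pos hε)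
  exact ⟨ν, hν, (dist_eq_norm μ ν).trans_lt (by linarith)⟩

end CKDiameterTwo

/-! ### The equivalences -/

theorem corollary6p5 (K : Type*) [TopologicalSpace K] [CompactSpace K] [T2Space K] :
    List.TFAE [
      ℵ₁ ≤ #K,
      CKDiameterTwo.SD2P C(K, ℝ) ℵ₀,
      CKDiameterTwo.OneASD2P C(K, ℝ) ℵ₀,
      ¬ TopologicalSpace.SeparableSpace (StrongDual ℝ C(K, ℝ)),
      CKDiameterTwo.IsOctahedral (StrongDual ℝ C(K, ℝ)) ℵ₀,
      CKDiameterTwo.FailsNegOneBCP (StrongDual ℝ C(K, ℝ)) ℵ₀] := by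
  tfae_have 1 → 3 := CKDiameterTwo.oneASD2P_of_aleph_one_le
  tfae_have 3 → 2 := by
    intro h A hA hAc lam hlam
    obtain ⟨B, hB, g, hg, hBA, hgB⟩ := h A hA hAc
    exact ⟨B, hB, g, hg, hBA lam hlam, fun x hx => (hgB x hx).symm ▸ hlam.2.le⟩
  tfae_have 2 → 4 := CKDiameterTwo.not_separableSpace_of_SD2P
  tfae_have 4 → 1 := by
    intro h
    rw [Cardinal.aleph_one_le_iff, Cardinal.aleph0_lt_mk_iff]
    by_contra hK
    have : Countable K := not_uncountable_iff.1 hK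
    exact h CKDiameterTwo.separableSpace_dual_of_countable
  tfae_have 1 → 6 := CKDiameterTwo.failsNegOneBCP_of_aleph_one_le
  tfae_have 6 → 5 := by
    intro h Y hY ε hε
    obtain ⟨x, hx, hoct⟩ := h Y hY
    refine ⟨x, hx, fun y hy t => le_trans ?_ (hoct y hy t)⟩
    exact mul_le_mul_of_nonneg_right (by linarith) (by positivity)
  tfae_have 5 → 4 := CKDiameterTwo.IsOctahedral.not_separableSpace
  tfae_finish
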